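/- Let $M$ be a closed connected $d$-dimensional Riemannian manifold with fundamental group $\Gamma$, and let $\widetilde M$ be its universal cover with the induced Riemannian metric, on which $\Gamma$ acts by deck transformations. Let $X$ be the Cantor set with a free continuous $\Gamma$-action and a $\Gamma$-invariant Borel probability measure $\mu$; let $\Gamma$ act diagonally on $X\times\widetilde M$. Balls are open and come with a centre and a radius $r>0$; $aB$ denotes the concentric ball of radius $ar$. A *Cantor cover* of $X\times\widetilde M$ is a cover $\mathcal U=\{A_j\times B_j\mid j\in J\}$ with $A_j\subset X$ clopen and $B_j\subset\widetilde M$ a ball, indexed over a free $\Gamma$-set $J$ with finitely many orbits, such that $A_{\gamma j}=\gamma A_j$ and $B_{\gamma j}=\gamma B_j$, and such that $\{A_j\times\frac12B_j\mid j\in J\}$ is also a cover. It has *no self-intersections* if $(\gamma A_j\times\gamma B_j)\cap(A_j\times B_j)\neq\emptyset$ implies $\gamma=1$, for all $j\in J$, $\gamma\in\Gamma$. Put $\mathcal U_x=\{B_j\mid j\in J,\ x\in A_j\}$ for $x\in X$. Let $V(1)$ be the supremum of the volumes of the balls of radius $1$ in $\widetilde M$. A ball $B(p,r)\subset\widetilde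 M$ is *good* if $\operatorname{vol}(B(p,100r))\le 10^{4(d+3)}\operatorname{vol}(B(p,\frac1{100}r))$, $\operatorname{vol}(B(p,r))\le 10^{2(d+3)}\,V(1)\,r^{d+3}$ and $r\le\frac1{100}$. The Cantor cover $\mathcal U$ is *good* if for every $x\in X$ the family $\mathcal U_x$ is a cover of $\widetilde M$ by good balls whose concentric $\frac16$-balls are pairwise disjoint and whose concentric $\frac12$-balls still cover $\widetilde M$. For a $\Gamma$-invariant Borel set $S\subset X\times\widetilde M$ the *transverse volume* is $$\operatorname{vol}^{\mathrm{tr}}_d(S)=\int_X\operatorname{vol}\bigl(\{p\in\widetilde M\mid (x,p)\in S\cap F\}\bigr)\,d\mu(x),$$ where $F$ is any Borel fundamental domain of $\Gamma\curvearrowright X\times\widetilde M$. **Theorem.** Let $\alpha(d)=-\log(1-10^{-16(d+3)})>0$ and $\beta(d)=10^{8(d+3)}>0$. Let $\mathcal U$ be a good Cantor cover of $X\times\widetilde M$ without self-intersections, and for $(x,p)\in X\times\widetilde M$ let $m_x(p)$ be the number of balls of $\mathcal U_x$ that contain $p$. Then there is a Borel fundamental domain for $\Gamma\curvearrowright X\times\widetilde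 M$, and for every real $\lambda\ge1$ the set $\{(x,p)\mid m_x(p)\ge\lambda+\beta(d)\}$ is Borel and $\Gamma$-invariant, and $$\operatorname{vol}^{\mathrm{tr}}_d\bigl(\{(x,p)\mid m_x(p)\ge\lambda+\beta(d)\}\bigr)\le e^{-\alpha(d)\lambda}\cdot\operatorname{vol}(M).$$ -/

import Mathlib

open MeasureTheory Metric Set Bundle
open scoped ENNReal Pointwise Manifold ContDiff

namespace CantorCovers

noncomputable section

/-- The Riemannian volume of a `d`-dimensional Riemannian manifold: the `d`-dimensional Hausdorff
measure of the Riemannian distance, normalised to agree with Lebesgue measure on `ℝ^d`. -/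
def vol (d : ℕ) {N : Type*} [MetricSpace N] [MeasurableSpace N] [BorelSpace N] : Measure N :=
  Measure.euclideanHausdorffMeasure d

/-- `V_N(1)`, the supremal volume of the balls of radius `1`. -/
def supUnitBallVol (d : ℕ) (N : Type*) [MetricSpace N] [MeasurableSpace N] [BorelSpace N] :
    ℝ≥0∞ :=
  ⨆ p : N, vol d (ball p 1)

/-- Good balls. A ball is a pair of a centre `p` and a radius `r`, so that concentric balls
make sense. -/
structure IsGoodBall (d : ℕ) {N : Type*} [MetricSpace N] [MeasurableSpace N] [BorelSpace N]
    (p : N) (r : ℝ) : Prop where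
  radius_pos : 0 < r
  reasonable_growth :
    vol d (ball p (100 * r)) ≤ 10 ^ (4 * (d + 3)) * vol d (ball p (1 / 100 * r))
  volume_bound :
    vol d (ball p r) ≤ 10 ^ (2 * (d + 3)) * supUnitBallVol d N * ENNReal.ofReal r ^ (d + 3)
  small_radius : r ≤ 1 / 100

/-- Good covers: covers by good balls such that the concentric `1/6`-balls are disjoint and the
concentric `1/2`-balls still cover. A set of balls is a set of pairs (centre, radius). -/
structure IsGoodCover (d : ℕ) {N : Type*} [MetricSpace N] [MeasurableSpace N] [BorelSpace N]
    (V : Set (N × ℝ)) : Prop where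
  good : ∀ b ∈ V, IsGoodBall d b.1 b.2
  cover : ∀ p : N, ∃ b ∈ V, p ∈ ball b.1 b.2
  sixth_disjoint : V.PairwiseDisjoint fun b => ball b.1 (1 / 6 * b.2)
  half_cover : ∀ p : N, ∃ b ∈ V, p ∈ ball b.1 (1 / 2 * b.2)

/-- The multiplicity of the point `p` with respect to a set of balls: the number of balls in the
set which contain `p`. -/
def multiplicity {N : Type*} [MetricSpace N] (V : Set (N × ℝ)) (p : N) : ℕ∞ :=
  {b ∈ V | p ∈ ball b.1 b.2}.encard

/-- Cantor covers of `X × N`, where the group `Γ` acts on `X` and on `N`, with free cofinite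
index set `J`. -/
structure CantorCover (Γ X N J : Type*) [Group Γ] [TopologicalSpace X] [MulAction Γ X]
    [MetricSpace N] [MulAction Γ N] [MulAction Γ J] where
  /-- the clopen sets `A_j` -/
  A : J → Set X
  /-- the centres of the balls `B_j` -/
  center : J → N
  /-- the radii of the balls `B_j` -/
  radius : J → ℝ
  free : ∀ (γ : Γ) (j : J), γ • j = j → γ = 1
  cofinite : Finite (MulAction.orbitRel.Quotient Γ J)
  isClopen : ∀ j, IsClopen (A j)
  radius_pos : ∀ j, 0 < radius j
  A_smul : ∀ (γ : Γ) (j : J), A (γ • j) = γ • A j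
  center_smul : ∀ (γ : Γ) (j : J), center (γ • j) = γ • center j
  radius_smul : ∀ (γ : Γ) (j : J), radius (γ • j) = radius j
  cover : ∀ (x : X) (p : N), ∃ j, x ∈ A j ∧ p ∈ ball (center j) (radius j)
  half_cover : ∀ (x : X) (p : N), ∃ j, x ∈ A j ∧ p ∈ ball (center j) (1 / 2 * radius j)

namespace CantorCover

variable {Γ X N J : Type*} [Group Γ] [TopologicalSpace X] [MulAction Γ X]
  [MetricSpace N] [MulAction Γ N] [MulAction Γ J]

/-- The ball `B_j`. -/
def B (U : CantorCover Γ X N J) (j : J) : Set N := ball (U.center j) (U.radius j)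

/-- The induced cover `U_x = {B_j | x ∈ A_j}` of the fibre over `x`. -/
def fiber (U : CantorCover Γ X N J) (x : X) : Set (N × ℝ) :=
  {b | ∃ j, x ∈ U.A j ∧ b = (U.center j, U.radius j)}

/-- The cover has no self-intersections. -/
def NoSelfIntersections (U : CantorCover Γ X N J) : Prop :=
  ∀ (j : J) (γ : Γ), (((γ • U.A j) ×ˢ (γ • U.B j)) ∩ (U.A j ×ˢ U.B j)).Nonempty → γ = 1

/-- The cover is good, i.e. all the induced covers `U_x` are good. -/
def IsGood (d : ℕ) [MeasurableSpace N] [BorelSpace N] (U : CantorCover Γ X N J) : Prop :=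
  ∀ x : X, IsGoodCover d (U.fiber x)

/-- The set of the points `(x, p)` at which the fibrewise multiplicity is at least `t`. -/
def highMultiplicitySet (U : CantorCover Γ X N J) (t : ℝ) : Set (X × N) :=
  {w | ENNReal.ofReal t ≤ (multiplicity (U.fiber w.1) w.2 : ℝ≥0∞)}

end CantorCover

/-- Borel fundamental domains of an action. -/
def IsBorelFundamentalDomain (Γ : Type*) {W : Type*} [Group Γ] [MulAction Γ W]
    [MeasurableSpace W] (F : Set W) : Prop :=
  MeasurableSet F ∧ ∀ w : W, ∃! γ : Γ, γ • w ∈ F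

/-- The `d`-dimensional Hausdorff measure `∫_X vol_d(S ∩ ({x} × N)) dμ(x)` of a set
`S ⊆ X × N`. -/
def bundleVol (d : ℕ) {X N : Type*} [MeasurableSpace X] [MetricSpace N] [MeasurableSpace N]
    [BorelSpace N] (μ : Measure X) (S : Set (X × N)) : ℝ≥0∞ :=
  ∫⁻ x, vol d {p : N | (x, p) ∈ S} ∂μ

/-- The transverse volume of a set `S ⊆ X × N`, computed with the fundamental domain `F`. -/
def transverseVol (d : ℕ) {X N : Type*} [MeasurableSpace X] [MetricSpace N] [MeasurableSpace N]
    [BorelSpace N] (μ : Measure X) (F S : Set (X × N)) : ℝ≥0∞ :=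
  bundleVol d μ (S ∩ F)

/-- The dimensional constant `α(d) = -log(1 - 10^(-16(d+3)))`. -/
def alphaConst (d : ℕ) : ℝ := -Real.log (1 - ((10 : ℝ) ^ (16 * (d + 3)))⁻¹)

/-- The dimensional constant `β(d) = 10^(8(d+3))`. -/
def betaConst (d : ℕ) : ℝ := (10 : ℝ) ^ (8 * (d + 3))

/-- `pr : N → M` is the universal covering of the `d`-dimensional Riemannian manifold `M`, `N`
carries the Riemannian metric induced by `M`, and `Γ`, acting on `N`, is its group of deck
transformations (which is a copy of the fundamental group of `M`). -/
structure IsRiemannianUniversalCovering (d : ℕ) (Γ : Type*) {M N : Type*} [Group Γ]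
    [MetricSpace M] [ChartedSpace (EuclideanSpace ℝ (Fin d)) M]
    [RiemannianBundle (fun x : M => TangentSpace (𝓡 d) x)]
    [MetricSpace N] [ChartedSpace (EuclideanSpace ℝ (Fin d)) N]
    [RiemannianBundle (fun x : N => TangentSpace (𝓡 d) x)]
    [MulAction Γ N] (pr : N → M) : Prop where
  simplyConnected : SimplyConnectedSpace N
  isQuotientCoveringMap : IsQuotientCoveringMap pr Γ
  contMDiff : ContMDiff (𝓡 d) (𝓡 d) ∞ pr
  inner_mfderiv : ∀ (p : N) (v w : TangentSpace (𝓡 d) p),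
    inner ℝ (mfderiv (𝓡 d) (𝓡 d) pr p v) (mfderiv (𝓡 d) (𝓡 d) pr p w) = inner ℝ v w

end

end CantorCovers

/-!
The idea is a Vitali argument carried out fibrewise and equivariantly.

*Layers.* Over `x : X`, the balls of `U_x` are coloured greedily with the colours `1, 2, …`, larger
balls first, so that intersecting balls get different colours (`greedyColor`, `CantorCover.color`).
The colouring treats the finitely many `Γ`-orbits of balls one after the other; since the cover has
no self-intersections, balls of one orbit over the same `x` are disjoint and never compete. Hence
the colouring is `Γ`-equivariant, and it depends measurably on `x`.

*Decay.* Let `W_n` be the part of `X × N` covered by the balls of colour at least `n`, and let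
`C = 10 ^ (4 (d + 3))` be the growth constant of good balls. A ball of colour greater than `n` meets
a ball of colour `n` which is at least as large, so the threefold enlargements of the balls of
colour `n` cover `W_n` (`CantorCover.highLayerSet_subset`). Let `a_n` be the transverse volume of
the concentric sixths of the balls of colour `n`. Unfolding the orbits (`tsum_measure_inter_le`)
turns the growth bound into `vol W_n ≤ C a_n`. The sixths of all the balls are disjoint
(`CantorCover.disjoint_layerBox`), and those of colour at least `n` lie in `W_n`, so
`∑_{i ≥ n} a_i ≤ vol W_n ≤ C a_n`. This makes the tails of `∑ a_i` decay by the factor `1 - 1 / C`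
in each step, whence `vol W_{n + 1} ≤ C (1 - 1 / C) ^ n vol M`
(`CantorCover.measure_highLayerSet_inter_le`). A point of multiplicity `t` lies in balls of at least
`t` distinct colours, hence in `W_⌈t⌉`. As `β = C ^ 2` and `α = -log (1 - C ^ (-4)) ≤ 1 / C`, the
shift by `β` absorbs the constant `C` and the rate is better than `α` (`mul_geometric_le_exp`).

*Geometry.* Two facts about the covering `pr : N → M` enter: `Γ` acts on `N` by isometries
(`IsRiemannianUniversalCovering.isIsometricSMul`), and `pr` is locally expanding
(`IsRiemannianUniversalCovering.exists_isOpen_edist_le`), so that a fundamental domain has at most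
the volume of `M` (`exists_isBorelFundamentalDomain_vol_le`). Both follow because a continuous lift
of a `C^1` path is `C^1` of the same length.
-/

/-! ### Lifting paths through a Riemannian covering -/

namespace CantorCovers

section Riemannian

open Manifold Filter Topology

variable {d : ℕ} {Γ M N : Type*} [Group Γ]
  [MetricSpace M] [ChartedSpace (EuclideanSpace ℝ (Fin d)) M]
  [RiemannianBundle (fun x : M => TangentSpace (𝓡 d) x)]
  [MetricSpace N] [ChartedSpace (EuclideanSpace ℝ (Fin d)) N]
  [RiemannianBundle (fun x : N => TangentSpace (𝓡 d) x)]
  [MulAction Γ N] {pr : N → M}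

theorem IsRiemannianUniversalCovering.norm_mfderiv (h : IsRiemannianUniversalCovering d Γ pr)
    (p : N) (v : TangentSpace (𝓡 d) p) : ‖mfderiv (𝓡 d) (𝓡 d) pr p v‖ = ‖v‖ := by
  rw [norm_eq_sqrt_real_inner, norm_eq_sqrt_real_inner, h.inner_mfderiv]

theorem IsRiemannianUniversalCovering.enorm_mfderiv (h : IsRiemannianUniversalCovering d Γ pr)
    (p : N) (v : TangentSpace (𝓡 d) p) : ‖mfderiv (𝓡 d) (𝓡 d) pr p v‖ₑ = ‖v‖ₑ := by
  rw [enorm_eq_iff_norm_eq, h.norm_mfderiv]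

theorem IsRiemannianUniversalCovering.mfderiv_injective
    (h : IsRiemannianUniversalCovering d Γ pr) (p : N) :
    Function.Injective (mfderiv (𝓡 d) (𝓡 d) pr p) := by
  rw [injective_iff_map_eq_zero]
  intro v hv
  have := h.norm_mfderiv p v
  rw [hv, norm_zero] at this
  exact norm_eq_zero.1 this.symm

theorem IsRiemannianUniversalCovering.isLocalHomeomorph
    (h : IsRiemannianUniversalCovering d Γ pr) : IsLocalHomeomorph pr :=
  (IsQuotientCoveringMap.isCoveringMap pr Γ h.isQuotientCoveringMap).isLocalHomeomorph

omit [RiemannianBundle (fun x : M => TangentSpace (𝓡 d) x)]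
  [RiemannianBundle (fun x : N => TangentSpace (𝓡 d) x)] in
/-- The easy half of the inverse function theorem on manifolds: a local inverse of a `C^1` map with
injective derivative is `C^1`. -/
theorem contMDiffAt_symm_of_mfderiv_injective [IsManifold (𝓡 d) 1 M] [IsManifold (𝓡 d) 1 N]
    (e : OpenPartialHomeomorph N M)
    {a : M} (ha : a ∈ e.target) (he : ContMDiffAt (𝓡 d) (𝓡 d) 1 e (e.symm a))
    (hinj : Function.Injective (mfderiv (𝓡 d) (𝓡 d) e (e.symm a))) :
    ContMDiffAt (𝓡 d) (𝓡 d) 1 e.symm a := by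
  set p := e.symm a with hp
  have hep : e p = a := e.right_inv ha
  have hps : p ∈ e.source := e.map_target ha
  let φ := chartAt (EuclideanSpace ℝ (Fin d)) p
  let ψ := chartAt (EuclideanSpace ℝ (Fin d)) a
  -- `e` read in the charts at `p` and `a`
  let g := (φ.symm.trans e).trans ψ
  have hsymm : g.symm (ψ a) = φ p := by
    simp only [g, OpenPartialHomeomorph.coe_trans_symm, Function.comp_apply,
      OpenPartialHomeomorph.symm_symm]
    rw [ψ.left_inv (mem_chart_source _ a)]
  have hmem : ψ a ∈ g.target := by
    rw [← OpenPartialHomeomorph.symm_source]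
    simp only [g, OpenPartialHomeomorph.trans_symm_eq_symm_trans_symm,
      OpenPartialHomeomorph.trans_source, OpenPartialHomeomorph.symm_source,
      OpenPartialHomeomorph.symm_symm, mem_inter_iff, mem_preimage]
    refine ⟨mem_chart_target _ a, ?_, ?_⟩
    · rw [ψ.left_inv (mem_chart_source _ a)]; exact ha
    · rw [ψ.left_inv (mem_chart_source _ a)]; exact mem_chart_source _ p
  have hg : ContDiffAt ℝ 1 g (g.symm (ψ a)) := by
    rw [hsymm]
    have := (contMDiffAt_iff.1 he).2
    rw [hep] at this
    simpa [g, φ, ψ, Function.comp_def, contDiffWithinAt_univ] using this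
  let D : EuclideanSpace ℝ (Fin d) →L[ℝ] EuclideanSpace ℝ (Fin d) := mfderiv (𝓡 d) (𝓡 d) e p
  have hd : HasFDerivAt g D (g.symm (ψ a)) := by
    have : HasFDerivWithinAt (writtenInExtChartAt (𝓡 d) (𝓡 d) p e) D (range (𝓡 d))
        (extChartAt (𝓡 d) p p) := (he.mdifferentiableAt one_ne_zero).hasMFDerivAt.2
    rw [hsymm]
    simpa [g, φ, ψ, writtenInExtChartAt, Function.comp_def, hep, hasFDerivWithinAt_univ] using this
  let L : EuclideanSpace ℝ (Fin d) ≃L[ℝ] EuclideanSpace ℝ (Fin d) :=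
    (LinearEquiv.ofInjectiveEndo
      (D : EuclideanSpace ℝ (Fin d) →ₗ[ℝ] EuclideanSpace ℝ (Fin d)) hinj).toContinuousLinearEquiv
  have hL : HasFDerivAt g (L : EuclideanSpace ℝ (Fin d) →L[ℝ] EuclideanSpace ℝ (Fin d))
      (g.symm (ψ a)) := by
    have hLD : (L : EuclideanSpace ℝ (Fin d) →L[ℝ] EuclideanSpace ℝ (Fin d)) = D :=
      ContinuousLinearMap.ext fun v => rfl
    rw [hLD]
    exact hd
  have key := g.contDiffAt_symm hmem hL hg
  refine contMDiffAt_iff.2 ⟨e.symm.continuousAt ha, ?_⟩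
  simpa [g, φ, ψ, Function.comp_def, ← hp, contDiffWithinAt_univ] using key

variable [IsManifold (𝓡 d) ∞ M] [IsManifold (𝓡 d) ∞ N]

omit [IsManifold (𝓡 d) ∞ M] [IsManifold (𝓡 d) ∞ N] in
theorem IsRiemannianUniversalCovering.contMDiff_one
    (h : IsRiemannianUniversalCovering d Γ pr) : ContMDiff (𝓡 d) (𝓡 d) 1 pr :=
  h.contMDiff.of_le (by exact_mod_cast le_top)

/-- A continuous lift of a `C^1` path is `C^1`. -/
theorem IsRiemannianUniversalCovering.contMDiffOn_lift
    (h : IsRiemannianUniversalCovering d Γ pr) {η : ℝ → N} {s : Set ℝ} (hη : ContinuousOn η s)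
    (hη' : ContMDiffOn 𝓘(ℝ, ℝ) (𝓡 d) 1 (pr ∘ η) s) : ContMDiffOn 𝓘(ℝ, ℝ) (𝓡 d) 1 η s := by
  have : IsManifold (𝓡 d) 1 M := .of_le (n := ∞) (by exact_mod_cast le_top)
  have : IsManifold (𝓡 d) 1 N := .of_le (n := ∞) (by exact_mod_cast le_top)
  intro t ht
  obtain ⟨e, hte, he⟩ := h.isLocalHomeomorph (η t)
  have hpe : pr (η t) ∈ e.target := by rw [he]; exact e.map_source hte
  have hsy : e.symm (pr (η t)) = η t := by rw [he]; exact e.left_inv hte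
  have hs : ContMDiffAt (𝓡 d) (𝓡 d) 1 e.symm (pr (η t)) :=
    contMDiffAt_symm_of_mfderiv_injective e hpe (he ▸ h.contMDiff_one _)
      (he ▸ h.mfderiv_injective _)
  refine (hs.comp_contMDiffWithinAt t (hη' t ht)).congr_of_eventuallyEq ?_ hsy.symm
  filter_upwards [(hη t ht) (e.open_source.mem_nhds hte)] with u hu
  rw [Function.comp_apply, Function.comp_apply, he]
  exact (e.left_inv hu).symm

omit [IsManifold (𝓡 d) ∞ M] [IsManifold (𝓡 d) ∞ N] in
theorem IsRiemannianUniversalCovering.pathELength_comp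
    (h : IsRiemannianUniversalCovering d Γ pr) {η : ℝ → N} {a b : ℝ}
    (hη : ContMDiffOn 𝓘(ℝ, ℝ) (𝓡 d) 1 η (Icc a b)) :
    pathELength (𝓡 d) (pr ∘ η) a b = pathELength (𝓡 d) η a b := by
  rw [pathELength_eq_lintegral_mfderiv_Ioo, pathELength_eq_lintegral_mfderiv_Ioo]
  refine setLIntegral_congr_fun measurableSet_Ioo fun t ht => ?_
  have hd : MDifferentiableAt 𝓘(ℝ, ℝ) (𝓡 d) η t :=
    ((hη t ⟨ht.1.le, ht.2.le⟩).contMDiffAt (Icc_mem_nhds ht.1 ht.2)).mdifferentiableAt one_ne_zero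
  rw [mfderiv_comp t ((h.contMDiff _).mdifferentiableAt (by simp)) hd]
  exact h.enorm_mfderiv (η t) _

/-- Deck transformations do not increase lengths, because they move a path to another lift of its
projection to `M`. -/
theorem IsRiemannianUniversalCovering.riemannianEDist_smul_le
    (h : IsRiemannianUniversalCovering d Γ pr) (γ : Γ) (p q : N) :
    riemannianEDist (𝓡 d) (γ • p) (γ • q) ≤ riemannianEDist (𝓡 d) p q := by
  refine le_of_forall_gt fun r hr => ?_
  obtain ⟨η, h0, h1, hη, hlen⟩ := exists_lt_of_riemannianEDist_lt hr
  have := h.isQuotientCoveringMap.toContinuousConstSMul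
  have hproj : pr ∘ (fun t => γ • η t) = pr ∘ η :=
    funext fun t => h.isQuotientCoveringMap.map_smul γ
  have hlift : ContMDiffOn 𝓘(ℝ, ℝ) (𝓡 d) 1 (fun t => γ • η t) (Icc 0 1) := by
    refine h.contMDiffOn_lift (hη.continuousOn.const_smul γ) ?_
    rw [hproj]
    exact h.contMDiff_one.comp_contMDiffOn hη
  refine (riemannianEDist_le_pathELength hlift (by simp [h0]) (by simp [h1])
    zero_le_one).trans_lt ?_
  rwa [← h.pathELength_comp hlift, hproj, h.pathELength_comp hη]

theorem IsRiemannianUniversalCovering.isIsometricSMul [IsRiemannianManifold (𝓡 d) N]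
    (h : IsRiemannianUniversalCovering d Γ pr) : IsIsometricSMul Γ N where
  isometry_smul γ p q := by
    have key : ∀ (γ : Γ) (p q : N), edist (γ • p) (γ • q) ≤ edist p q := fun γ p q => by
      rw [IsRiemannianManifold.out (I := 𝓡 d), IsRiemannianManifold.out (I := 𝓡 d) p q]
      exact h.riemannianEDist_smul_le γ p q
    refine le_antisymm (key γ p q) ?_
    simpa using key γ⁻¹ (γ • p) (γ • q)

/-- The covering projection is locally expanding (in fact, locally isometric). -/
theorem IsRiemannianUniversalCovering.exists_isOpen_edist_le [IsRiemannianManifold (𝓡 d) M]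
    [IsRiemannianManifold (𝓡 d) N] (h : IsRiemannianUniversalCovering d Γ pr) (p₀ : N) :
    ∃ V : Set N, IsOpen V ∧ p₀ ∈ V ∧ ∀ p ∈ V, ∀ q ∈ V, edist p q ≤ edist (pr p) (pr q) := by
  obtain ⟨e, hpe, he⟩ := h.isLocalHomeomorph p₀
  have hpt : pr p₀ ∈ e.target := by rw [he]; exact e.map_source hpe
  obtain ⟨ε, hε, hball⟩ := EMetric.isOpen_iff.1 e.open_target _ hpt
  have hcont : Continuous pr := h.contMDiff.continuous
  have hε3 : 0 < ε / 3 := ENNReal.div_pos hε.ne' (by simp)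
  refine ⟨e.source ∩ pr ⁻¹' eball (pr p₀) (ε / 3),
    e.open_source.inter (isOpen_eball.preimage hcont),
    ⟨hpe, mem_eball_self hε3⟩, ?_⟩
  rintro p ⟨hp, hp'⟩ q ⟨hq, hq'⟩
  refine le_of_forall_gt fun r hr => ?_
  have hpq : edist (pr p) (pr q) < ε / 3 + ε / 3 :=
    (edist_triangle_right _ _ (pr p₀)).trans_lt (ENNReal.add_lt_add hp' hq')
  have hlt : riemannianEDist (𝓡 d) (pr p) (pr q) < min r (ε / 3 + ε / 3) := by
    rw [← IsRiemannianManifold.out (I := 𝓡 d)]; exact lt_min hr hpq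
  obtain ⟨η, h0, h1, hη, hlen⟩ := exists_lt_of_riemannianEDist_lt hlt
  -- the path is too short to leave the domain of the local section
  have hstay : ∀ t ∈ Icc (0 : ℝ) 1, η t ∈ e.target := fun t ht => by
    apply hball
    have hxt : edist (pr p) (η t) < ε / 3 + ε / 3 := by
      rw [IsRiemannianManifold.out (I := 𝓡 d)]
      refine ((riemannianEDist_le_pathELength (hη.mono (Icc_subset_Icc_right ht.2)) h0 rfl
        ht.1).trans (pathELength_mono le_rfl ht.2)).trans_lt (hlen.trans_le (min_le_right _ _))
    calc edist (η t) (pr p₀) ≤ edist (pr p) (pr p₀) + edist (pr p) (η t) := by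
          rw [add_comm, edist_comm (pr p) (η t)]; exact edist_triangle _ _ _
      _ < ε / 3 + (ε / 3 + ε / 3) := ENNReal.add_lt_add hp' hxt
      _ = ε := by rw [← add_assoc, ENNReal.add_thirds]
  have hproj : ∀ t ∈ Icc (0 : ℝ) 1, pr (e.symm (η t)) = η t := fun t ht => by
    rw [he, e.right_inv (hstay t ht)]
  have hlift : ContMDiffOn 𝓘(ℝ, ℝ) (𝓡 d) 1 (e.symm ∘ η) (Icc 0 1) :=
    h.contMDiffOn_lift (e.symm.continuousOn.comp hη.continuousOn hstay)
      (hη.congr fun t ht => hproj t ht)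
  rw [IsRiemannianManifold.out (I := 𝓡 d)]
  refine (riemannianEDist_le_pathELength hlift (x := p) (y := q) ?_ ?_ zero_le_one).trans_lt ?_
  · rw [Function.comp_apply, h0, he, e.left_inv hp]
  · rw [Function.comp_apply, h1, he, e.left_inv hq]
  · rw [← h.pathELength_comp hlift,
      pathELength_congr (γ := pr ∘ e.symm ∘ η) (γ' := η) fun t ht => hproj t ht]
    exact hlen.trans_le (min_le_left _ _)

end Riemannian
end CantorCovers

/-! ### Fundamental domains and unfolding -/

namespace CantorCovers

section FundamentalDomain

/-- The inverse of an expanding map is `1`-Lipschitz, so the map does not decrease volumes. -/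
theorem vol_le_vol_image {d : ℕ} {M N : Type*} [MetricSpace M] [MeasurableSpace M] [BorelSpace M]
    [MetricSpace N] [MeasurableSpace N] [BorelSpace N] {f : N → M} {S : Set N}
    (h : ∀ p ∈ S, ∀ q ∈ S, edist p q ≤ edist (f p) (f q)) : vol d S ≤ vol d (f '' S) := by
  rcases S.eq_empty_or_nonempty with rfl | ⟨p₀, -⟩
  · simp
  have : Nonempty N := ⟨p₀⟩
  have hinj : InjOn f S := fun p hp q hq hpq =>
    edist_le_zero.1 ((h p hp q hq).trans_eq (by rw [hpq, edist_self]))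
  have hinv : LeftInvOn (Function.invFunOn f S) f S := hinj.leftInvOn_invFunOn
  have hlip : LipschitzOnWith 1 (Function.invFunOn f S) (f '' S) := by
    rintro _ ⟨p, hp, rfl⟩ _ ⟨q, hq, rfl⟩
    rw [hinv hp, hinv hq, ENNReal.coe_one, one_mul]
    exact h p hp q hq
  have key := hlip.hausdorffMeasure_image_le (d := d) (by positivity)
  rw [hinv.image_image, ENNReal.coe_one, ENNReal.one_rpow, one_mul] at key
  simp only [vol, Measure.euclideanHausdorffMeasure_def, Measure.smul_apply]
  gcongr

theorem smulInvariantMeasure_vol (d : ℕ) {Γ N : Type*} [Group Γ] [MetricSpace N]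
    [MeasurableSpace N] [BorelSpace N] [MulAction Γ N] [IsIsometricSMul Γ N] :
    SMulInvariantMeasure Γ N (vol d) where
  measure_preimage_smul γ _s hs :=
    ((IsometryEquiv.constSMul γ).measurePreserving_euclideanHausdorffMeasure d).measure_preimage
      hs.nullMeasurableSet

section Covering

variable {d : ℕ} {Γ M N : Type*} [Group Γ] [MetricSpace M] [MeasurableSpace M] [BorelSpace M]
  [MetricSpace N] [SecondCountableTopology N] [MeasurableSpace N] [BorelSpace N]
  [MulAction Γ N] {pr : N → M}

omit [MeasurableSpace M] [BorelSpace M] [MeasurableSpace N] [BorelSpace N] in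
theorem countable_of_isQuotientCoveringMap [Nonempty N] (h : IsQuotientCoveringMap pr Γ) :
    Countable Γ := by
  obtain ⟨p⟩ := ‹Nonempty N›
  obtain ⟨U, hU, hdisj⟩ := h.disjoint p
  have := h.toContinuousConstSMul
  refine Pairwise.countable_of_isOpen_disjoint (s := fun γ : Γ => γ • interior U) ?_
    (fun γ => isOpen_interior.smul γ) fun γ =>
      ⟨γ • p, smul_mem_smul_set (mem_interior_iff_mem_nhds.2 hU)⟩
  intro γ γ' hne
  rw [Function.onFun, Set.disjoint_left]
  rintro _ ⟨a, ha, rfl⟩ ⟨b, hb, hab⟩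
  refine hne (inv_mul_eq_one.1 (hdisj (γ'⁻¹ * γ)
    ⟨b, ⟨a, interior_subset ha, ?_⟩, interior_subset hb⟩)).symm
  simp only at hab ⊢
  rw [mul_smul, ← hab, inv_smul_smul]

/-- A quotient covering map which is locally expanding has a Borel fundamental domain whose volume
is at most the volume of the quotient. It is glued from pieces of the sheets over a countable
partition of the quotient. -/
theorem exists_isBorelFundamentalDomain_vol_le [Nonempty N] (h : IsQuotientCoveringMap pr Γ)
    (hexp : ∀ p₀ : N, ∃ V : Set N, IsOpen V ∧ p₀ ∈ V ∧
      ∀ p ∈ V, ∀ q ∈ V, edist p q ≤ edist (pr p) (pr q)) :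
    ∃ D : Set N, IsBorelFundamentalDomain Γ D ∧ vol d D ≤ vol d (univ : Set M) := by
  choose V hVo hVm hV using hexp
  obtain ⟨s, hsc, hs⟩ := TopologicalSpace.countable_cover_nhds
    fun p => (hVo p).mem_nhds (hVm p)
  have hsne : s.Nonempty := by
    obtain ⟨p⟩ := ‹Nonempty N›
    obtain ⟨i, hi, -⟩ := mem_iUnion₂.1 (hs ▸ mem_univ p : p ∈ ⋃ x ∈ s, V x)
    exact ⟨i, hi⟩
  obtain ⟨f, rfl⟩ := hsc.exists_eq_range hsne
  have hcov : ∀ p : N, ∃ i, p ∈ V (f i) := fun p => by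
    have : p ∈ ⋃ x ∈ range f, V x := hs ▸ mem_univ p
    simpa using this
  have hopen : IsOpenMap pr := (IsQuotientCoveringMap.isOpenQuotientMap pr Γ h).isOpenMap
  have hcont : Continuous pr := h.toIsQuotientMap.continuous
  let W : ℕ → Set M := fun i => pr '' V (f i)
  have hWm : ∀ i, MeasurableSet (W i) := fun i => (hopen _ (hVo _)).measurableSet
  have hQm : ∀ i, MeasurableSet (disjointed W i) := fun i => MeasurableSet.disjointed hWm i
  have hsub : ∀ i, pr '' (V (f i) ∩ pr ⁻¹' disjointed W i) ⊆ disjointed W i := by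
    rintro i _ ⟨p, hp, rfl⟩
    exact hp.2
  refine ⟨⋃ i, V (f i) ∩ pr ⁻¹' disjointed W i,
    ⟨MeasurableSet.iUnion fun i => (hVo _).measurableSet.inter (hcont.measurable (hQm i)), ?_⟩, ?_⟩
  · intro p
    have hp : pr p ∈ ⋃ i, disjointed W i := by
      rw [iUnion_disjointed]
      obtain ⟨i, hi⟩ := hcov p
      exact mem_iUnion.2 ⟨i, p, hi, rfl⟩
    obtain ⟨i, hi⟩ := mem_iUnion.1 hp
    obtain ⟨q, hq, hqp⟩ := disjointed_subset W i hi
    obtain ⟨γ, hγ⟩ := h.apply_eq_iff_mem_orbit.1 hqp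
    simp only at hγ
    refine ⟨γ, mem_iUnion.2 ⟨i, by rw [hγ]; exact hq, ?_⟩, fun γ' hγ' => ?_⟩
    · rw [mem_preimage, h.map_smul]; exact hi
    · -- a translate in another piece would project to another part of the partition of `M`
      obtain ⟨j, hj, hj'⟩ := mem_iUnion.1 hγ'
      rw [mem_preimage, h.map_smul] at hj'
      have hij : j = i := by
        by_contra hne
        exact Set.disjoint_left.1 (disjoint_disjointed W hne) hj' hi
      subst hij
      have heq : γ' • p = γ • p := by
        refine edist_le_zero.1 ((hV _ _ hj _ (by rw [hγ]; exact hq)).trans_eq ?_)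
        rw [h.map_smul, h.map_smul, edist_self]
      have := h.isCancelSMul
      exact IsCancelSMul.right_cancel _ _ _ heq
  · calc vol d (⋃ i, V (f i) ∩ pr ⁻¹' disjointed W i)
        ≤ ∑' i, vol d (V (f i) ∩ pr ⁻¹' disjointed W i) := measure_iUnion_le _
      _ ≤ ∑' i, vol d (disjointed W i) := ENNReal.tsum_le_tsum fun i =>
          (vol_le_vol_image fun p hp q hq => hV _ p hp.1 q hq.1).trans (measure_mono (hsub i))
      _ = vol d (⋃ i, disjointed W i) :=
          (measure_iUnion (disjoint_disjointed W) hQm).symm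
      _ ≤ vol d univ := measure_mono (subset_univ _)

omit [SecondCountableTopology N] in
theorem isLocallyFiniteMeasure_vol (hM : vol d (univ : Set M) ≠ ⊤)
    (hexp : ∀ p₀ : N, ∃ V : Set N, IsOpen V ∧ p₀ ∈ V ∧
      ∀ p ∈ V, ∀ q ∈ V, edist p q ≤ edist (pr p) (pr q)) :
    IsLocallyFiniteMeasure (vol d : Measure N) where
  finiteAtNhds p := by
    obtain ⟨V, hVo, hVm, hV⟩ := hexp p
    exact ⟨V, hVo.mem_nhds hVm,
      ((vol_le_vol_image hV).trans (measure_mono (subset_univ _))).trans_lt hM.lt_top⟩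

end Covering

section Action

variable {Γ W : Type*} [Group Γ] [MulAction Γ W] [MeasurableSpace W]

theorem IsBorelFundamentalDomain.isFundamentalDomain {F : Set W}
    (h : IsBorelFundamentalDomain Γ F) (ν : Measure W) : IsFundamentalDomain Γ F ν where
  nullMeasurableSet := h.1.nullMeasurableSet
  ae_covers := Filter.Eventually.of_forall fun w => (h.2 w).exists
  aedisjoint := fun γ γ' hne => by
    refine Disjoint.aedisjoint (Set.disjoint_left.2 fun w hw hw' => hne ?_)
    rw [mem_smul_set_iff_inv_smul_mem] at hw hw'
    exact inv_injective ((h.2 w).unique hw hw')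

theorem IsBorelFundamentalDomain.univ_prod {X : Type*} [MeasurableSpace X] [MulAction Γ X]
    {D : Set W} (h : IsBorelFundamentalDomain Γ D) :
    IsBorelFundamentalDomain Γ ((univ : Set X) ×ˢ D) :=
  ⟨MeasurableSet.univ.prod h.1, fun w => by simpa using h.2 w.2⟩

theorem measurableConstSMul_prod {X : Type*} [MeasurableSpace X] [MulAction Γ X]
    [MeasurableConstSMul Γ X] [MeasurableConstSMul Γ W] : MeasurableConstSMul Γ (X × W) where
  measurable_const_smul γ :=
    (measurable_fst.const_smul γ).prodMk (measurable_snd.const_smul γ)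

theorem smulInvariantMeasure_prod {X : Type*} [MeasurableSpace X] [MulAction Γ X]
    [MeasurableConstSMul Γ X] [MeasurableConstSMul Γ W] (μ : Measure X) (ν : Measure W)
    [SigmaFinite μ] [SigmaFinite ν] [SMulInvariantMeasure Γ X μ] [SMulInvariantMeasure Γ W ν] :
    SMulInvariantMeasure Γ (X × W) (μ.prod ν) where
  measure_preimage_smul γ _s hs :=
    ((measurePreserving_smul γ μ).prod (measurePreserving_smul γ ν)).measure_preimage
      hs.nullMeasurableSet

/-- A free `Γ`-set is the product of its orbit space and `Γ`. The identification depends on the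
choice of a point in each orbit. -/
noncomputable def quotientProdEquiv {J : Type*} [MulAction Γ J]
    (hfree : ∀ (γ : Γ) (j : J), γ • j = j → γ = 1) :
    MulAction.orbitRel.Quotient Γ J × Γ ≃ J :=
  Equiv.ofBijective (fun w => w.2 • w.1.out) <| by
    have hout : ∀ w : MulAction.orbitRel.Quotient Γ J × Γ,
        Quotient.mk (MulAction.orbitRel Γ J) (w.2 • w.1.out) = w.1 := fun w => by
      conv_rhs => rw [← Quotient.out_eq w.1]
      exact Quotient.sound ⟨w.2, rfl⟩
    refine ⟨fun w w' hw => ?_, fun j => ?_⟩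
    · have h1 : w.1 = w'.1 := by
        simp only at hw
        rw [← hout w, hw, hout w']
      refine Prod.ext h1 (inv_mul_eq_one.1 (hfree _ w.1.out ?_)).symm
      simp only at hw
      rw [mul_smul, hw, h1, inv_smul_smul]
    · obtain ⟨γ, hγ⟩ : j ∈ MulAction.orbit Γ (Quotient.mk (MulAction.orbitRel Γ J) j).out :=
        MulAction.orbitRel_apply.1 ((MulAction.orbitRel Γ J).symm' (Quotient.exact (Quotient.out_eq
          (Quotient.mk (MulAction.orbitRel Γ J) j))))
      exact ⟨(Quotient.mk (MulAction.orbitRel Γ J) j, γ), hγ⟩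

theorem tsum_eq_tsum_quotient_tsum {J : Type*} [MulAction Γ J]
    (hfree : ∀ (γ : Γ) (j : J), γ • j = j → γ = 1) (f : J → ℝ≥0∞) :
    ∑' j, f j = ∑' (o : MulAction.orbitRel.Quotient Γ J) (γ : Γ), f (γ • o.out) := by
  rw [← (quotientProdEquiv hfree).tsum_eq f, ENNReal.tsum_prod']
  rfl

/-- Unfolding: a `Γ`-equivariant comparison of the measures of single sets yields a comparison of
the total measures inside a fundamental domain. -/
theorem tsum_measure_inter_le {J : Type*} [MulAction Γ J] [Countable Γ]
    (hfree : ∀ (γ : Γ) (j : J), γ • j = j → γ = 1) [MeasurableConstSMul Γ W] {ν : Measure W}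
    [SMulInvariantMeasure Γ W ν] {F : Set W} (hF : IsFundamentalDomain Γ F ν)
    {E E' : J → Set W} (hE : ∀ (γ : Γ) j, E (γ • j) = γ • E j)
    (hE' : ∀ (γ : Γ) j, E' (γ • j) = γ • E' j) {c : ℝ≥0∞} (hle : ∀ j, ν (E j) ≤ c * ν (E' j)) :
    ∑' j, ν (E j ∩ F) ≤ c * ∑' j, ν (E' j ∩ F) := by
  rw [tsum_eq_tsum_quotient_tsum hfree, tsum_eq_tsum_quotient_tsum hfree, ← ENNReal.tsum_mul_left]
  refine ENNReal.tsum_le_tsum fun o => ?_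
  simp only [hE, hE']
  rw [← hF.measure_eq_tsum, ← hF.measure_eq_tsum]
  exact hle _

end Action

theorem transverseVol_eq {d : ℕ} {X N : Type*} [MeasurableSpace X] [MetricSpace N]
    [MeasurableSpace N] [BorelSpace N] (μ : Measure X) [SFinite (vol d : Measure N)]
    {F S : Set (X × N)} (hF : MeasurableSet F) (hS : MeasurableSet S) :
    transverseVol d μ F S = μ.prod (vol d) (S ∩ F) := by
  rw [Measure.prod_apply (hS.inter hF)]
  rfl

end FundamentalDomain
end CantorCovers

/-! ### Greedy colourings -/

namespace CantorCovers

section GreedyColoring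

open Classical in
/-- The greedy colouring of the active vertices of a graph, processed in the order of their rank:
an active vertex receives the least colour `≥ 1` which none of its neighbours of smaller rank has.
The colour `0` marks the inactive vertices. -/
noncomputable def greedyColor {J : Type*} (rank : J → ℕ) (adj : J → J → Prop) (act : Set J) :
    J → ℕ
  | j => if j ∈ act then
      sInf {k | 1 ≤ k ∧ ∀ i, (_ : rank i < rank j) → adj i j → greedyColor rank adj act i ≠ k}
    else 0
termination_by j => rank j

variable {J : Type*} {rank : J → ℕ} {adj : J → J → Prop} {act : Set J} {j : J}

theorem greedyColor_of_notMem (hj : j ∉ act) : greedyColor rank adj act j = 0 := by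
  rw [greedyColor, if_neg hj]

theorem greedyColor_of_mem (hj : j ∈ act) : greedyColor rank adj act j =
    sInf {k | 1 ≤ k ∧ ∀ i, rank i < rank j → adj i j → greedyColor rank adj act i ≠ k} := by
  rw [greedyColor, if_pos hj]

theorem greedyColor_le (j : J) : greedyColor rank adj act j ≤ rank j + 1 := by
  induction hn : rank j using Nat.strong_induction_on generalizing j with
  | _ n ih =>
    subst hn
    by_cases hj : j ∈ act
    · rw [greedyColor_of_mem hj]
      refine Nat.sInf_le ⟨by omega, fun i hi _ => ?_⟩
      have := ih _ hi i rfl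
      omega
    · simp [greedyColor_of_notMem hj]

theorem greedyColor_spec (hj : j ∈ act) : 1 ≤ greedyColor rank adj act j ∧
    ∀ i, rank i < rank j → adj i j →
      greedyColor rank adj act i ≠ greedyColor rank adj act j := by
  rw [greedyColor_of_mem hj]
  refine Nat.sInf_mem
    (s := {k | 1 ≤ k ∧ ∀ i, rank i < rank j → adj i j → greedyColor rank adj act i ≠ k})
    ⟨rank j + 1, by omega, fun i hi _ => ?_⟩
  have := greedyColor_le (rank := rank) (adj := adj) (act := act) i
  omega

theorem mem_of_one_le_greedyColor (hj : 1 ≤ greedyColor rank adj act j) : j ∈ act := by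
  by_contra h
  rw [greedyColor_of_notMem h] at hj
  omega

theorem exists_greedyColor_eq {k : ℕ} (hk : 1 ≤ k) (hkj : k < greedyColor rank adj act j) :
    ∃ i, rank i < rank j ∧ adj i j ∧ greedyColor rank adj act i = k := by
  have hj : j ∈ act := mem_of_one_le_greedyColor (hk.trans hkj.le)
  rw [greedyColor_of_mem hj] at hkj
  have := Nat.notMem_of_lt_sInf hkj
  simp only [mem_ofPred_eq, not_and, not_forall, not_not] at this
  obtain ⟨i, hi, hij, hc⟩ := this hk
  exact ⟨i, hi, hij, hc⟩

/-- A recursive description of the colour classes, which expresses them by set operations in terms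
of the colour classes of smaller rank. -/
theorem greedyColor_eq_iff {k : ℕ} (hk : 1 ≤ k) : greedyColor rank adj act j = k ↔
    j ∈ act ∧ (∀ i, rank i < rank j → adj i j → greedyColor rank adj act i ≠ k) ∧
      ∀ l, 1 ≤ l → l < k → ∃ i, rank i < rank j ∧ adj i j ∧ greedyColor rank adj act i = l := by
  constructor
  · rintro rfl
    have hj := mem_of_one_le_greedyColor hk
    exact ⟨hj, (greedyColor_spec hj).2, fun l hl hlk => exists_greedyColor_eq hl hlk⟩
  · rintro ⟨hj, h1, h2⟩
    have hspec := greedyColor_spec (rank := rank) (adj := adj) hj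
    rcases lt_trichotomy (greedyColor rank adj act j) k with h | h | h
    · obtain ⟨i, hi, hij, hc⟩ := h2 _ hspec.1 h
      exact absurd hc (hspec.2 i hi hij)
    · exact h
    · obtain ⟨i, hi, hij, hc⟩ := exists_greedyColor_eq hk h
      exact absurd hc (h1 i hi hij)

/-- The greedy colouring is natural under rank-preserving automorphisms of the graph. -/
theorem greedyColor_equiv {act' : Set J} (σ : J ≃ J) (hrank : ∀ i, rank (σ i) = rank i)
    (hadj : ∀ i j, adj (σ i) (σ j) ↔ adj i j) (hact : ∀ i, σ i ∈ act' ↔ i ∈ act) (j : J) :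
    greedyColor rank adj act' (σ j) = greedyColor rank adj act j := by
  induction hn : rank j using Nat.strong_induction_on generalizing j with
  | _ n ih =>
    subst hn
    by_cases hj : j ∈ act
    · rw [greedyColor_of_mem hj, greedyColor_of_mem ((hact j).2 hj)]
      congr 1
      ext k
      refine and_congr_right fun _ => ⟨fun h i hi hij => ?_, fun h i hi hij => ?_⟩
      · rw [← ih _ hi i rfl]
        exact h (σ i) (by rwa [hrank, hrank]) ((hadj i j).2 hij)
      · obtain ⟨i, rfl⟩ := σ.surjective i
        rw [hrank, hrank] at hi
        rw [ih _ hi i rfl]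
        exact h i hi ((hadj i j).1 hij)
    · rw [greedyColor_of_notMem hj, greedyColor_of_notMem fun h => hj ((hact j).1 h)]

end GreedyColoring

/-! ### The layers of a Cantor cover -/

namespace CantorCover

variable {Γ X N J : Type*} [Group Γ] [TopologicalSpace X] [MulAction Γ X]
  [MetricSpace N] [MulAction Γ N] [MulAction Γ J]

/-- An enumeration of the orbits of the index set of a Cantor cover, by decreasing radius. -/
structure IsOrbitRank (U : CantorCover Γ X N J) (rank : J → ℕ) : Prop where
  rank_smul : ∀ (γ : Γ) j, rank (γ • j) = rank j
  exists_smul_eq : ∀ {i j}, rank i = rank j → ∃ γ : Γ, γ • i = j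
  radius_le : ∀ {i j}, rank i < rank j → U.radius j ≤ U.radius i

theorem exists_isOrbitRank (U : CantorCover Γ X N J) : ∃ rank, U.IsOrbitRank rank := by
  have := U.cofinite
  obtain ⟨n, ⟨e⟩⟩ := Finite.exists_equiv_fin (MulAction.orbitRel.Quotient Γ J)
  let mk : J → MulAction.orbitRel.Quotient Γ J := Quotient.mk (MulAction.orbitRel Γ J)
  have hmk : ∀ {i j}, mk i = mk j ↔ ∃ γ : Γ, γ • i = j := fun {i j} =>
    ⟨fun h => MulAction.orbitRel_apply.1 ((MulAction.orbitRel Γ J).symm' (Quotient.exact h)),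
      fun h => Quotient.sound ((MulAction.orbitRel Γ J).symm' (MulAction.orbitRel_apply.2 h))⟩
  let f : Fin n → ℝ := fun a => -U.radius (e.symm a).out
  have hf : ∀ j, f (e (mk j)) = -U.radius j := fun j => by
    obtain ⟨γ, hγ⟩ : ∃ γ : Γ, γ • (mk j).out = j := hmk.1 (Quotient.out_eq (mk j))
    simp only [f, Equiv.symm_apply_apply]
    conv_rhs => rw [← hγ, U.radius_smul]
  -- `Tuple.sort` sorts increasingly, whence the sign in `f`
  let σ := Tuple.sort f
  have hinj : ∀ {i j}, ((σ.symm (e (mk i)) : Fin n) : ℕ) = σ.symm (e (mk j)) ↔ mk i = mk j :=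
    fun {i j} => by rw [← Fin.ext_iff, σ.symm.injective.eq_iff, e.injective.eq_iff]
  refine ⟨fun j => (σ.symm (e (mk j)) : Fin n),
    ⟨fun γ j => hinj.2 (hmk.2 ⟨γ⁻¹, inv_smul_smul γ j⟩), fun h => hmk.1 (hinj.1 h), ?_⟩⟩
  intro i j h
  have := Tuple.monotone_sort f (le_of_lt (Fin.lt_def.2 h))
  simp only [Function.comp_apply] at this
  change f (σ (σ.symm _)) ≤ f (σ (σ.symm _)) at this
  rw [Equiv.apply_symm_apply, Equiv.apply_symm_apply, hf, hf] at this
  linarith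

theorem countable_index [Countable Γ] (U : CantorCover Γ X N J) : Countable J := by
  have := U.cofinite
  exact (quotientProdEquiv U.free).symm.injective.countable

variable (U : CantorCover Γ X N J)

theorem B_smul [IsIsometricSMul Γ N] (γ : Γ) (j : J) : U.B (γ • j) = γ • U.B j := by
  rw [B, B, U.center_smul, U.radius_smul, Metric.smul_ball]

theorem mem_A_smul_iff {γ : Γ} {j : J} {x : X} : γ • x ∈ U.A (γ • j) ↔ x ∈ U.A j := by
  rw [U.A_smul, smul_mem_smul_set_iff]

theorem mem_B_smul_iff [IsIsometricSMul Γ N] {γ : Γ} {j : J} {p : N} :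
    γ • p ∈ U.B (γ • j) ↔ p ∈ U.B j := by
  rw [U.B_smul, smul_mem_smul_set_iff]

/-- The indices which are active at `x`: the ball `B_j` belongs to `U_x`, and `j` is the index of
least rank which represents it. Distinct active indices represent distinct balls of `U_x`. -/
def active (rank : J → ℕ) (x : X) : Set J :=
  {j | x ∈ U.A j ∧ ∀ i, rank i < rank j → x ∈ U.A i →
    ¬(U.center i = U.center j ∧ U.radius i = U.radius j)}

/-- The greedy colouring of the balls of `U_x`, larger balls first, where intersecting balls get
different colours. -/
noncomputable def color (rank : J → ℕ) (x : X) : J → ℕ :=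
  greedyColor rank (fun i j => (U.B i ∩ U.B j).Nonempty) (U.active rank x)

/-- The set of the points `x` such that `B_j` has the colour `k` in `U_x`. -/
def layer (rank : J → ℕ) (k : ℕ) (j : J) : Set X := {x | U.color rank x j = k}

variable {U} {rank : J → ℕ}

theorem mem_active_of_one_le_color {x : X} {j : J} (h : 1 ≤ U.color rank x j) :
    j ∈ U.active rank x :=
  mem_of_one_le_greedyColor h

theorem mem_active_smul_iff (hr : U.IsOrbitRank rank) {γ : Γ} {x : X} {j : J} :
    γ • j ∈ U.active rank (γ • x) ↔ j ∈ U.active rank x := by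
  refine and_congr U.mem_A_smul_iff ⟨fun h i hi hx hij => ?_, fun h i hi hx hij => ?_⟩
  · refine h (γ • i) (by rwa [hr.rank_smul, hr.rank_smul]) (U.mem_A_smul_iff.2 hx) ?_
    simpa [U.center_smul, U.radius_smul] using hij
  · refine h (γ⁻¹ • i) (by rwa [hr.rank_smul, ← hr.rank_smul γ j]) ?_ ?_
    · rwa [← U.mem_A_smul_iff (γ := γ), smul_inv_smul]
    · rw [U.center_smul, U.radius_smul] at hij ⊢
      exact ⟨by rw [hij.1, inv_smul_smul], hij.2⟩

theorem color_smul [IsIsometricSMul Γ N] (hr : U.IsOrbitRank rank) (γ : Γ) (x : X) (j : J) :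
    U.color rank (γ • x) (γ • j) = U.color rank x j :=
  greedyColor_equiv (MulAction.toPerm γ) (hr.rank_smul γ)
    (fun i j => by
      simp only [MulAction.toPerm_apply, U.B_smul, ← smul_set_inter, smul_set_nonempty])
    (fun _ => mem_active_smul_iff hr) j

theorem layer_smul [IsIsometricSMul Γ N] (hr : U.IsOrbitRank rank) (k : ℕ) (γ : Γ) (j : J) :
    U.layer rank k (γ • j) = γ • U.layer rank k j := by
  ext x
  rw [mem_smul_set_iff_inv_smul_mem]
  simp only [layer, mem_ofPred_eq]
  rw [← color_smul hr γ (γ⁻¹ • x) j, smul_inv_smul]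

theorem measurableSet_active [MeasurableSpace X] [BorelSpace X] [Countable J] (j : J) :
    MeasurableSet {x | j ∈ U.active rank x} := by
  have hA : ∀ i, MeasurableSet (U.A i) := fun i => (U.isClopen i).isOpen.measurableSet
  have : {x | j ∈ U.active rank x} = U.A j ∩ ⋂ i, ⋂ (_ : rank i < rank j),
      ⋂ (_ : U.center i = U.center j ∧ U.radius i = U.radius j), (U.A i)ᶜ := by
    ext x
    simp only [active, mem_ofPred_eq, mem_inter_iff, mem_iInter, mem_compl_iff]
    exact and_congr_right fun _ => forall₂_congr fun i _ => imp_not_comm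
  rw [this]
  exact (hA j).inter (.iInter fun i => .iInter fun _ => .iInter fun _ => (hA i).compl)

theorem measurableSet_layer [MeasurableSpace X] [BorelSpace X] [Countable J] (k : ℕ) (j : J) :
    MeasurableSet (U.layer rank k j) := by
  induction hn : rank j using Nat.strong_induction_on generalizing j k with
  | _ n ih =>
    subst hn
    have hact := measurableSet_active (U := U) (rank := rank) j
    rcases k.eq_zero_or_pos with rfl | hk
    · convert! hact.compl using 1
      ext x
      refine ⟨fun (h : U.color rank x j = 0) hj => ?_, fun h => greedyColor_of_notMem h⟩
      have := (greedyColor_spec (rank := rank) (act := U.active rank x)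
        (adj := fun i j => (U.B i ∩ U.B j).Nonempty) hj).1
      exact absurd h (Nat.one_le_iff_ne_zero.1 this)
    · have : U.layer rank k j = {x | j ∈ U.active rank x} ∩
          ((⋂ i, ⋂ (_ : rank i < rank j), ⋂ (_ : (U.B i ∩ U.B j).Nonempty), (U.layer rank k i)ᶜ) ∩
          ⋂ l, ⋂ (_ : 1 ≤ l), ⋂ (_ : l < k),
            ⋃ i, ⋃ (_ : rank i < rank j), ⋃ (_ : (U.B i ∩ U.B j).Nonempty), U.layer rank l i) := by
        ext x
        simp only [mem_inter_iff, mem_iInter, mem_iUnion, mem_compl_iff, exists_prop]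
        exact greedyColor_eq_iff hk
      rw [this]
      refine hact.inter (MeasurableSet.inter ?_ ?_)
      · exact .iInter fun i => .iInter fun hi => .iInter fun _ => (ih _ hi k i rfl).compl
      · exact .iInter fun l => .iInter fun _ => .iInter fun _ =>
          .iUnion fun i => .iUnion fun hi => .iUnion fun _ => ih _ hi l i rfl

/-- Without self-intersections, the balls of one orbit over the same point are disjoint. -/
theorem eq_of_rank_eq [IsIsometricSMul Γ N] (hr : U.IsOrbitRank rank)
    (hself : U.NoSelfIntersections) {x : X} {i j : J} (hi : x ∈ U.A i) (hj : x ∈ U.A j)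
    (hij : rank i = rank j) (hB : (U.B i ∩ U.B j).Nonempty) : i = j := by
  obtain ⟨γ, rfl⟩ := hr.exists_smul_eq hij
  obtain ⟨p, hp, hp'⟩ := hB
  have : γ = 1 := hself i γ ⟨(x, p), ⟨by rwa [← U.A_smul], by rwa [← U.B_smul]⟩, hi, hp⟩
  rw [this, one_smul]

theorem eq_of_mem_active [IsIsometricSMul Γ N] (hr : U.IsOrbitRank rank)
    (hself : U.NoSelfIntersections) {x : X} {i j : J} (hi : i ∈ U.active rank x)
    (hj : j ∈ U.active rank x) (hc : U.center i = U.center j) (hrad : U.radius i = U.radius j) :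
    i = j := by
  rcases lt_trichotomy (rank i) (rank j) with h | h | h
  · exact absurd ⟨hc, hrad⟩ (hj.2 i h hi.1)
  · exact eq_of_rank_eq hr hself hi.1 hj.1 h
      ⟨U.center i, mem_ball_self (U.radius_pos i), hc ▸ mem_ball_self (U.radius_pos j)⟩
  · exact absurd ⟨hc.symm, hrad.symm⟩ (hi.2 j h hj.1)

/-- At a given point of `X × N`, distinct balls have distinct colours. -/
theorem eq_of_color_eq [IsIsometricSMul Γ N] (hr : U.IsOrbitRank rank)
    (hself : U.NoSelfIntersections) {x : X} {p : N} {i j : J} (hi : i ∈ U.active rank x)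
    (hj : j ∈ U.active rank x) (hpi : p ∈ U.B i) (hpj : p ∈ U.B j)
    (hc : U.color rank x i = U.color rank x j) : i = j := by
  rcases lt_trichotomy (rank i) (rank j) with h | h | h
  · exact absurd hc ((greedyColor_spec hj).2 i h ⟨p, hpi, hpj⟩)
  · exact eq_of_rank_eq hr hself hi.1 hj.1 h ⟨p, hpi, hpj⟩
  · exact absurd hc.symm ((greedyColor_spec hi).2 j h ⟨p, hpj, hpi⟩)

theorem exists_mem_active {x : X} {b : N × ℝ} (hb : b ∈ U.fiber x) :
    ∃ j ∈ U.active rank x, (U.center j, U.radius j) = b := by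
  have hne : {j | x ∈ U.A j ∧ b = (U.center j, U.radius j)}.Nonempty := hb
  obtain ⟨j, ⟨hj, hbj⟩, hmin⟩ := exists_minimalFor_of_wellFoundedLT
    (fun j => x ∈ U.A j ∧ b = (U.center j, U.radius j)) rank hne
  refine ⟨j, ⟨hj, fun i hi hx hij => ?_⟩, hbj.symm⟩
  have := hmin ⟨hx, by rw [hbj, hij.1, hij.2]⟩ hi.le
  omega

/-- The multiplicity counts balls rather than indices. The active indices represent each ball
exactly once. -/
theorem multiplicity_fiber [IsIsometricSMul Γ N] (hr : U.IsOrbitRank rank)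
    (hself : U.NoSelfIntersections) (x : X) (p : N) :
    multiplicity (U.fiber x) p = {j ∈ U.active rank x | p ∈ U.B j}.encard := by
  have hinj : InjOn (fun j => (U.center j, U.radius j)) {j ∈ U.active rank x | p ∈ U.B j} :=
    fun i hi j hj hij => eq_of_mem_active hr hself hi.1 hj.1 (congrArg Prod.fst hij)
      (congrArg Prod.snd hij)
  rw [← hinj.encard_image, multiplicity]
  congr 1
  ext b
  constructor
  · rintro ⟨hb, hp⟩
    obtain ⟨j, hj, rfl⟩ := exists_mem_active (rank := rank) hb
    exact ⟨j, ⟨hj, hp⟩, rfl⟩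
  · rintro ⟨j, ⟨hj, hp⟩, rfl⟩
    exact ⟨⟨j, hj.1, rfl⟩, hp⟩

theorem measurableSet_highMultiplicitySet [MeasurableSpace X] [BorelSpace X] [MeasurableSpace N]
    [BorelSpace N] [IsIsometricSMul Γ N] [Countable Γ] (hself : U.NoSelfIntersections) (t : ℝ) :
    MeasurableSet (U.highMultiplicitySet t) := by
  obtain ⟨rank, hr⟩ := U.exists_isOrbitRank
  have := U.countable_index
  have hS : ∀ j, MeasurableSet ({x | j ∈ U.active rank x} ×ˢ U.B j) := fun j =>
    (measurableSet_active j).prod measurableSet_ball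
  have hmeas : Measurable fun w : X × N =>
      ∑' j, ({x | j ∈ U.active rank x} ×ˢ U.B j).indicator (fun _ => (1 : ℝ≥0∞)) w :=
    Measurable.tsum fun j => measurable_const.indicator (hS j)
  convert! measurableSet_le measurable_const hmeas using 1
  ext w
  rw [highMultiplicitySet, mem_ofPred_eq, mem_ofPred_eq, multiplicity_fiber hr hself,
    ← ENNReal.tsum_set_one, tsum_subtype _ (fun _ => (1 : ℝ≥0∞))]
  rfl

theorem smul_highMultiplicitySet [IsIsometricSMul Γ N] (hself : U.NoSelfIntersections) (γ : Γ)
    (t : ℝ) : γ • U.highMultiplicitySet t = U.highMultiplicitySet t := by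
  obtain ⟨rank, hr⟩ := U.exists_isOrbitRank
  ext w
  rw [mem_smul_set_iff_inv_smul_mem]
  simp only [highMultiplicitySet, mem_ofPred_eq, multiplicity_fiber hr hself]
  have : {j ∈ U.active rank w.1 | w.2 ∈ U.B j} =
      (γ • ·) '' {j ∈ U.active rank (γ⁻¹ • w).1 | (γ⁻¹ • w).2 ∈ U.B j} := by
    ext j
    rw [image_smul, mem_smul_set_iff_inv_smul_mem, mem_ofPred_eq, mem_ofPred_eq, Prod.smul_fst,
      Prod.smul_snd, mem_active_smul_iff hr, U.mem_B_smul_iff]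
  rw [this, (MulAction.injective γ).encard_image]

end CantorCover
end CantorCovers

/-! ### Geometric decay -/

namespace CantorCovers

section Decay

/-- A summable sequence whose tails are at most `C` times their first term has geometrically
decaying tails. -/
theorem tsum_tail_le_geometric {b : ℕ → ℝ} (hs : Summable b) {C : ℝ} (hC : 1 ≤ C)
    (htail : ∀ n, ∑' i, b (n + i) ≤ C * b n) (n : ℕ) :
    ∑' i, b (n + i) ≤ (1 - 1 / C) ^ n * ∑' i, b i := by
  have hC0 : 0 < C := by linarith
  have hq : 0 ≤ 1 - 1 / C := by
    rw [sub_nonneg, div_le_one hC0]; exact hC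
  induction n with
  | zero => simp
  | succ n ih =>
    have hs' : Summable fun i => b (n + i) := by
      simpa only [add_comm n] using (summable_nat_add_iff n).2 hs
    have hsplit : ∑' i, b (n + i) = b n + ∑' i, b (n + 1 + i) := by
      rw [hs'.tsum_eq_zero_add]
      simp only [add_zero, add_assoc, add_comm 1]
    have h1 : 1 / C * ∑' i, b (n + i) ≤ b n := by
      rw [one_div, inv_mul_le_iff₀ hC0]; exact htail n
    calc ∑' i, b (n + 1 + i) = ∑' i, b (n + i) - b n := by rw [hsplit]; ring
      _ ≤ (1 - 1 / C) * ∑' i, b (n + i) := by linarith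
      _ ≤ (1 - 1 / C) * ((1 - 1 / C) ^ n * ∑' i, b i) := by gcongr
      _ = (1 - 1 / C) ^ (n + 1) * ∑' i, b i := by ring

/-- The version of `tsum_tail_le_geometric` for the terms of a sequence in `ℝ≥0∞`. -/
theorem le_geometric_of_tsum_tail_le {a : ℕ → ℝ≥0∞} {V : ℝ≥0∞} (hV : V ≠ ⊤) (hsum : ∑' i, a i ≤ V)
    {C : ℝ} (hC : 1 ≤ C) (htail : ∀ n, ∑' i, a (n + i) ≤ ENNReal.ofReal C * a n) (n : ℕ) :
    a n ≤ ENNReal.ofReal ((1 - 1 / C) ^ n) * V := by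
  have hC0 : 0 < C := by linarith
  have hq : 0 ≤ 1 - 1 / C := by
    rw [sub_nonneg, div_le_one hC0]; exact hC
  have hfin : ∑' i, a i ≠ ⊤ := ne_top_of_le_ne_top hV hsum
  have ha : ∀ i, a i ≠ ⊤ := ENNReal.ne_top_of_tsum_ne_top hfin
  have hs : Summable fun i => (a i).toReal := ENNReal.summable_toReal hfin
  have hconv : ∀ n, ∑' i, (a (n + i)).toReal = (∑' i, a (n + i)).toReal := fun n =>
    (ENNReal.tsum_toReal_eq fun i => ha _).symm
  have hreal : ∀ n, ∑' i, (a (n + i)).toReal ≤ C * (a n).toReal := fun n => by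
    rw [hconv, ← ENNReal.toReal_ofReal hC0.le, ← ENNReal.toReal_mul]
    exact ENNReal.toReal_mono (ENNReal.mul_ne_top ENNReal.ofReal_ne_top (ha n)) (htail n)
  have hle := tsum_tail_le_geometric hs hC hreal n
  have hs' : Summable fun i => (a (n + i)).toReal := by
    simpa only [add_comm n] using (summable_nat_add_iff n).2 hs
  have hfirst : (a n).toReal ≤ ∑' i, (a (n + i)).toReal :=
    hs'.le_tsum 0 fun i _ => ENNReal.toReal_nonneg
  have htot : ∑' i, (a i).toReal ≤ V.toReal := by
    rw [← ENNReal.tsum_toReal_eq ha]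
    exact ENNReal.toReal_mono hV hsum
  rw [← ENNReal.ofReal_toReal (ha n), ← ENNReal.ofReal_toReal hV,
    ← ENNReal.ofReal_mul (by positivity)]
  exact ENNReal.ofReal_le_ofReal (hfirst.trans (hle.trans (by gcongr)))

/-- The loss of a factor `1 - 1/C` for each unit of multiplicity, after a delay of `C^2`, is more
than what the exponent `-log (1 - C^(-4))` requires. -/
theorem mul_geometric_le_exp {C : ℝ} (hC : 2 ≤ C) {lam : ℝ} (hlam : 0 ≤ lam) {n : ℕ}
    (hn : lam + C ^ 2 ≤ n + 1) :
    C * (1 - 1 / C) ^ n ≤ Real.exp (-(-Real.log (1 - (C ^ 4)⁻¹) * lam)) := by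
  have hC0 : 0 < C := by linarith
  have hq : 0 ≤ 1 - 1 / C := by
    rw [sub_nonneg, div_le_one hC0]; linarith
  have hC4 : C + 1 ≤ C ^ 4 := by nlinarith [sq_nonneg (C ^ 2 - C), sq_nonneg C]
  have h4 : 0 < C ^ 4 - 1 := by linarith
  have hu : 0 < 1 - (C ^ 4)⁻¹ := by
    rw [sub_pos]; exact inv_lt_one_of_one_lt₀ (by linarith)
  have hlog : -(1 / C) ≤ Real.log (1 - (C ^ 4)⁻¹) := by
    refine le_trans ?_ (Real.one_sub_inv_le_log_of_pos hu)
    have : 1 - (1 - (C ^ 4)⁻¹)⁻¹ = -(1 / (C ^ 4 - 1)) := by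
      have h0 : C ^ 4 ≠ 0 := by positivity
      have : 1 - (C ^ 4)⁻¹ = (C ^ 4 - 1) / C ^ 4 := by field_simp
      rw [this, inv_div]
      field_simp
      ring
    rw [this, neg_le_neg_iff]
    exact one_div_le_one_div_of_le hC0 (by linarith)
  calc C * (1 - 1 / C) ^ n ≤ Real.exp (C - 1) * Real.exp (-(1 / C)) ^ n := by
        gcongr
        · linarith [Real.add_one_le_exp (C - 1)]
        · linarith [Real.add_one_le_exp (-(1 / C))]
    _ = Real.exp (C - 1 + n * -(1 / C)) := by rw [← Real.exp_nat_mul, ← Real.exp_add]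
    _ ≤ Real.exp (-(-Real.log (1 - (C ^ 4)⁻¹) * lam)) := by
        refine Real.exp_le_exp.2 ?_
        have h1 : -(1 / C) * lam ≤ Real.log (1 - (C ^ 4)⁻¹) * lam := by gcongr
        have h2 : (lam + C ^ 2 - 1) * (1 / C) ≤ n * (1 / C) := by gcongr; linarith
        have h3 : (lam + C ^ 2 - 1) * (1 / C) = lam * (1 / C) + C - 1 / C := by
          field_simp
        have h4 : 1 / C ≤ 1 := by rw [div_le_one hC0]; linarith
        linarith

theorem alphaConst_pos (d : ℕ) : 0 < alphaConst d := by
  have h : (1 : ℝ) < 10 ^ (16 * (d + 3)) := one_lt_pow₀ (by norm_num) (by omega)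
  rw [alphaConst, neg_pos]
  refine Real.log_neg (sub_pos.2 (inv_lt_one_of_one_lt₀ h)) ?_
  linarith [inv_pos.2 (zero_lt_one.trans h)]

theorem betaConst_pos (d : ℕ) : 0 < betaConst d := by
  unfold betaConst; positivity

/-- Enlarging a good ball threefold costs at most the growth constant over shrinking it to a
sixth. -/
theorem IsGoodBall.vol_three_le {d : ℕ} {N : Type*} [MetricSpace N] [MeasurableSpace N]
    [BorelSpace N] {p : N} {r : ℝ} (h : IsGoodBall d p r) :
    vol d (ball p (3 * r)) ≤ 10 ^ (4 * (d + 3)) * vol d (ball p (1 / 6 * r)) := by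
  have hr := h.radius_pos
  refine (measure_mono (ball_subset_ball (by linarith))).trans (h.reasonable_growth.trans ?_)
  gcongr
  norm_num

end Decay

/-! ### Volume of the layers -/

namespace CantorCover

variable {Γ X N J : Type*} [Group Γ] [TopologicalSpace X] [MulAction Γ X]
  [MetricSpace N] [MulAction Γ N] [MulAction Γ J] {U : CantorCover Γ X N J} {rank : J → ℕ}

variable (U) in
/-- The part of `X × N` covered by the concentric `t B_j` over the points at which `B_j` has the
colour `k`. -/
def layerBox (rank : J → ℕ) (t : ℝ) (k : ℕ) (j : J) : Set (X × N) :=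
  U.layer rank k j ×ˢ ball (U.center j) (t * U.radius j)

variable (U) in
/-- The part of `X × N` covered by the balls of colour at least `n`. -/
def highLayerSet (rank : J → ℕ) (n : ℕ) : Set (X × N) :=
  {w | ∃ j, n ≤ U.color rank w.1 j ∧ w.2 ∈ U.B j}

theorem layerBox_smul [IsIsometricSMul Γ N] (hr : U.IsOrbitRank rank) (t : ℝ) (k : ℕ) (γ : Γ)
    (j : J) : U.layerBox rank t k (γ • j) = γ • U.layerBox rank t k j := by
  ext w
  rw [mem_smul_set_iff_inv_smul_mem]
  simp only [layerBox, mem_prod, Prod.smul_fst, Prod.smul_snd]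
  rw [layer_smul hr, U.center_smul, U.radius_smul, ← Metric.smul_ball,
    mem_smul_set_iff_inv_smul_mem, mem_smul_set_iff_inv_smul_mem]

/-- The Vitali property of the greedy colouring: a ball of colour greater than `n` meets a ball of
colour `n` which is at least as large. -/
theorem highLayerSet_subset (hr : U.IsOrbitRank rank) {n : ℕ} (hn : 1 ≤ n) :
    U.highLayerSet rank n ⊆ ⋃ j, U.layerBox rank 3 n j := by
  rintro w ⟨j, hnj, hw⟩
  rw [B, mem_ball] at hw
  have hj := U.radius_pos j
  rcases hnj.eq_or_lt with h | h
  · exact mem_iUnion.2 ⟨j, h.symm, mem_ball.2 (by linarith)⟩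
  · obtain ⟨i, hi, ⟨q, hqi, hqj⟩, hc⟩ := exists_greedyColor_eq hn h
    rw [B, mem_ball] at hqi hqj
    refine mem_iUnion.2 ⟨i, hc, mem_ball.2 ?_⟩
    have := hr.radius_le hi
    have h1 := dist_triangle w.2 (U.center j) (U.center i)
    have h2 := dist_triangle_left (U.center j) (U.center i) q
    linarith

/-- A point of multiplicity `t` lies in balls of at least `t` different colours, and the largest of
these colours is at least `t`. -/
theorem highMultiplicitySet_subset [IsIsometricSMul Γ N] (hr : U.IsOrbitRank rank)
    (hself : U.NoSelfIntersections) {t : ℝ} {n : ℕ} (hn : (n : ℝ) < t) :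
    U.highMultiplicitySet t ⊆ U.highLayerSet rank (n + 1) := by
  intro w hw
  rw [highMultiplicitySet, mem_ofPred_eq, multiplicity_fiber hr hself] at hw
  by_contra hcon
  simp only [highLayerSet, mem_ofPred_eq, not_exists, not_and] at hcon
  have hsub : U.color rank w.1 '' {j ∈ U.active rank w.1 | w.2 ∈ U.B j} ⊆ Icc 1 n := by
    rintro _ ⟨j, ⟨hj, hwj⟩, rfl⟩
    refine ⟨(greedyColor_spec hj).1, ?_⟩
    by_contra hlt
    exact hcon j (by omega) hwj
  have hinj : InjOn (U.color rank w.1) {j ∈ U.active rank w.1 | w.2 ∈ U.B j} :=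
    fun i hi j hj hij => eq_of_color_eq hr hself hi.1 hj.1 hi.2 hj.2 hij
  have hcard : {j ∈ U.active rank w.1 | w.2 ∈ U.B j}.encard ≤ n := by
    rw [← hinj.encard_image]
    refine (encard_le_encard hsub).trans ?_
    rw [← Finset.coe_Icc, encard_coe_eq_coe_finsetCard, Nat.card_Icc]
    simp
  have hle : ENNReal.ofReal t ≤ (n : ℝ≥0∞) := hw.trans (by
    have := ENat.toENNReal_le.2 hcard
    simpa using this)
  rw [← ENNReal.ofReal_natCast] at hle
  have := (ENNReal.ofReal_le_ofReal_iff (Nat.cast_nonneg n)).1 hle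
  linarith

/-- The concentric sixths of the balls are disjoint, across all colours. -/
theorem disjoint_layerBox [MeasurableSpace N] [BorelSpace N] [IsIsometricSMul Γ N] {d : ℕ}
    (hr : U.IsOrbitRank rank) (hself : U.NoSelfIntersections) (hgood : U.IsGood d) {k l : ℕ}
    {i j : J} (hk : 1 ≤ k) (hl : 1 ≤ l) (hne : (k, i) ≠ (l, j)) :
    Disjoint (U.layerBox rank (1 / 6) k i) (U.layerBox rank (1 / 6) l j) := by
  refine Set.disjoint_left.2 ?_
  rintro ⟨x, p⟩ ⟨hki, hpi⟩ ⟨hlj, hpj⟩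
  have hki' : U.color rank x i = k := hki
  have hlj' : U.color rank x j = l := hlj
  have hi : i ∈ U.active rank x := mem_active_of_one_le_color (by omega)
  have hj : j ∈ U.active rank x := mem_active_of_one_le_color (by omega)
  have hij : (U.center i, U.radius i) ≠ (U.center j, U.radius j) := fun h => by
    have hij := eq_of_mem_active hr hself hi hj (congrArg Prod.fst h) (congrArg Prod.snd h)
    subst hij
    exact hne (by rw [← hki', ← hlj'])
  exact Set.disjoint_left.1
    ((hgood x).sixth_disjoint ⟨i, hi.1, rfl⟩ ⟨j, hj.1, rfl⟩ hij) hpi hpj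

section Measure

variable [MeasurableSpace X] [BorelSpace X] [MeasurableSpace N] [BorelSpace N]

theorem measurableSet_layerBox [Countable J] (t : ℝ) (k : ℕ) (j : J) :
    MeasurableSet (U.layerBox rank t k j) :=
  (measurableSet_layer k j).prod measurableSet_ball

/-- The total volume of the layers of colour at least `n` decays geometrically. -/
theorem measure_highLayerSet_inter_le [Countable Γ] [IsIsometricSMul Γ N] {d : ℕ}
    [MeasurableConstSMul Γ (X × N)] {μ : Measure X} [SFinite μ] [SFinite (vol d : Measure N)]
    [SMulInvariantMeasure Γ (X × N) (μ.prod (vol d))] (hr : U.IsOrbitRank rank)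
    (hself : U.NoSelfIntersections) (hgood : U.IsGood d) {F : Set (X × N)}
    (hF : IsBorelFundamentalDomain Γ F) (hfin : μ.prod (vol d) F ≠ ⊤) (n : ℕ) :
    μ.prod (vol d) (U.highLayerSet rank (n + 1) ∩ F) ≤
      ENNReal.ofReal (10 ^ (4 * (d + 3)) * (1 - 1 / 10 ^ (4 * (d + 3))) ^ n) *
        μ.prod (vol d) F := by
  have := U.countable_index
  set ν := μ.prod (vol d : Measure N) with hν
  set C : ℝ := 10 ^ (4 * (d + 3)) with hC
  have hC1 : 1 ≤ C := one_le_pow₀ (by norm_num)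
  have hCe : ENNReal.ofReal C = 10 ^ (4 * (d + 3)) := by
    rw [hC, ENNReal.ofReal_pow (by norm_num)]; norm_num
  let a : ℕ → ℝ≥0∞ := fun k => ∑' j, ν (U.layerBox rank (1 / 6) (k + 1) j ∩ F)
  have hbox : ∀ k j, ν (U.layerBox rank 3 (k + 1) j) ≤
      ENNReal.ofReal C * ν (U.layerBox rank (1 / 6) (k + 1) j) := fun k j => by
    rw [layerBox, layerBox, hν, Measure.prod_prod, Measure.prod_prod, hCe, mul_left_comm]
    rcases (U.layer rank (k + 1) j).eq_empty_or_nonempty with h | ⟨x, hx⟩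
    · simp [h]
    · have hx' : U.color rank x j = k + 1 := hx
      have hj : j ∈ U.active rank x := mem_active_of_one_le_color (by omega)
      gcongr
      exact ((hgood x).good _ ⟨j, hj.1, rfl⟩).vol_three_le
  have hW : ∀ k, ν (U.highLayerSet rank (k + 1) ∩ F) ≤ ENNReal.ofReal C * a k := fun k =>
    calc ν (U.highLayerSet rank (k + 1) ∩ F)
        ≤ ν (⋃ j, U.layerBox rank 3 (k + 1) j ∩ F) := by
          rw [← iUnion_inter]
          gcongr
          exact highLayerSet_subset hr (by omega)
      _ ≤ ∑' j, ν (U.layerBox rank 3 (k + 1) j ∩ F) := measure_iUnion_le _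
      _ ≤ ENNReal.ofReal C * a k :=
          tsum_measure_inter_le U.free (hF.isFundamentalDomain ν) (layerBox_smul hr 3 (k + 1))
            (layerBox_smul hr (1 / 6) (k + 1)) (hbox k)
  -- the concentric sixths are disjoint, and those of colour greater than `k` lie in the layers
  -- of colour greater than `k`
  have hcore : ∀ k, ∑' i, a (k + i) ≤ ν (U.highLayerSet rank (k + 1) ∩ F) := fun k => by
    simp only [a]
    rw [← ENNReal.tsum_prod'
      (f := fun w : ℕ × J => ν (U.layerBox rank (1 / 6) (k + w.1 + 1) w.2 ∩ F)), ← measure_iUnion]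
    · refine measure_mono (iUnion_subset fun w => ?_)
      rintro ⟨x, p⟩ ⟨⟨hx, hp⟩, hF'⟩
      have hx' : U.color rank x w.2 = k + w.1 + 1 := hx
      refine ⟨⟨w.2, by simp only [hx']; omega, ball_subset_ball ?_ hp⟩, hF'⟩
      linarith [U.radius_pos w.2]
    · intro w w' hne
      refine (disjoint_layerBox hr hself hgood (by omega) (by omega) ?_).mono inter_subset_left
        inter_subset_left
      intro h
      obtain ⟨h1, h2⟩ := Prod.mk.inj h
      exact hne (Prod.ext (by omega) h2)
    · exact fun w => (measurableSet_layerBox _ _ _).inter hF.1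
  have ha := le_geometric_of_tsum_tail_le hfin (V := ν F) (a := a)
    (by simpa using (hcore 0).trans (measure_mono inter_subset_right)) hC1
    (fun k => (hcore k).trans (hW k)) n
  calc ν (U.highLayerSet rank (n + 1) ∩ F) ≤ ENNReal.ofReal C * a n := hW n
    _ ≤ ENNReal.ofReal C * (ENNReal.ofReal ((1 - 1 / C) ^ n) * ν F) := by gcongr
    _ = _ := by rw [← mul_assoc, ← ENNReal.ofReal_mul (by positivity)]

end Measure

end CantorCover
end CantorCovers

/-! ### Exponential decay of the transverse volume -/

theorem theorem6 (d : ℕ) :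
    0 < CantorCovers.alphaConst d ∧ 0 < CantorCovers.betaConst d ∧
    ∀ {M N Γ X J : Type*}
      -- a closed `d`-dimensional Riemannian manifold `M`
      [MetricSpace M] [CompactSpace M] [ChartedSpace (EuclideanSpace ℝ (Fin d)) M]
      [IsManifold (𝓡 d) ∞ M] [RiemannianBundle (fun x : M => TangentSpace (𝓡 d) x)]
      [IsContMDiffRiemannianBundle (𝓡 d) ∞ (EuclideanSpace ℝ (Fin d))
        (fun x : M => TangentSpace (𝓡 d) x)]
      [IsRiemannianManifold (𝓡 d) M] [MeasurableSpace M] [BorelSpace M]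
      -- a `d`-dimensional Riemannian manifold `N`, the universal cover of `M`
      [MetricSpace N] [SecondCountableTopology N] [ChartedSpace (EuclideanSpace ℝ (Fin d)) N]
      [IsManifold (𝓡 d) ∞ N] [RiemannianBundle (fun x : N => TangentSpace (𝓡 d) x)]
      [IsContMDiffRiemannianBundle (𝓡 d) ∞ (EuclideanSpace ℝ (Fin d))
        (fun x : N => TangentSpace (𝓡 d) x)]
      [IsRiemannianManifold (𝓡 d) N] [MeasurableSpace N] [BorelSpace N]
      [Group Γ] [MulAction Γ N] (pr : N → M)
      (_hpr : CantorCovers.IsRiemannianUniversalCovering d Γ pr)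
      -- the Cantor set `X` with a free continuous action and an invariant probability measure
      [TopologicalSpace X] (_hX : Nonempty (X ≃ₜ cantorSet)) [MeasurableSpace X] [BorelSpace X]
      [MulAction Γ X] [ContinuousConstSMul Γ X] (_hfree : ∀ (γ : Γ) (x : X), γ • x = x → γ = 1)
      (μ : Measure X) [IsProbabilityMeasure μ] [SMulInvariantMeasure Γ X μ]
      -- a good Cantor cover of `X × N` without self-intersections
      [MulAction Γ J] (U : CantorCovers.CantorCover Γ X N J) (_hgood : U.IsGood d)
      (_hself : U.NoSelfIntersections),
      -- the transverse volume is defined ...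
      (∃ F : Set (X × N), CantorCovers.IsBorelFundamentalDomain Γ F) ∧
      ∀ lam : ℝ, 1 ≤ lam →
        MeasurableSet (U.highMultiplicitySet (lam + CantorCovers.betaConst d)) ∧
        (∀ γ : Γ, γ • U.highMultiplicitySet (lam + CantorCovers.betaConst d) =
          U.highMultiplicitySet (lam + CantorCovers.betaConst d)) ∧
        -- ... and decays exponentially
        ∀ F : Set (X × N), CantorCovers.IsBorelFundamentalDomain Γ F →
          CantorCovers.transverseVol d μ F
              (U.highMultiplicitySet (lam + CantorCovers.betaConst d)) ≤
            ENNReal.ofReal (Real.exp (-(CantorCovers.alphaConst d * lam))) *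
              CantorCovers.vol d (univ : Set M) := by
  refine ⟨CantorCovers.alphaConst_pos d, CantorCovers.betaConst_pos d, ?_⟩
  intro M N Γ X J _ _ _ _ _ _ _ _ _ _ _ _ _ _ _ _ _ _ _ _ pr hpr _ _ _ _ _ _ _ μ _ _ _ U hgood
    hself
  have : IsIsometricSMul Γ N := hpr.isIsometricSMul
  have : SimplyConnectedSpace N := hpr.simplyConnected
  have : Nonempty N := inferInstance
  have : Countable Γ := CantorCovers.countable_of_isQuotientCoveringMap hpr.isQuotientCoveringMap
  obtain ⟨D, hD, hDvol⟩ := CantorCovers.exists_isBorelFundamentalDomain_vol_le (d := d)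
    hpr.isQuotientCoveringMap hpr.exists_isOpen_edist_le
  refine ⟨⟨_, hD.univ_prod⟩, fun lam hlam =>
    ⟨CantorCovers.CantorCover.measurableSet_highMultiplicitySet hself _,
      fun γ => CantorCovers.CantorCover.smul_highMultiplicitySet hself γ _, fun F hF => ?_⟩⟩
  by_cases hM : CantorCovers.vol d (univ : Set M) = ⊤
  · -- the finiteness of `vol M`, which makes `vol` on `N` σ-finite, is only needed when the
    -- right-hand side is finite
    rw [hM, ENNReal.mul_top (by simp [Real.exp_pos])]
    exact le_top
  have : IsLocallyFiniteMeasure (CantorCovers.vol d : Measure N) :=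
    CantorCovers.isLocallyFiniteMeasure_vol hM hpr.exists_isOpen_edist_le
  have : MeasurableConstSMul Γ (X × N) := CantorCovers.measurableConstSMul_prod
  have : SMulInvariantMeasure Γ N (CantorCovers.vol d) := CantorCovers.smulInvariantMeasure_vol d
  have : SMulInvariantMeasure Γ (X × N) (μ.prod (CantorCovers.vol d)) :=
    CantorCovers.smulInvariantMeasure_prod μ _
  -- all fundamental domains have the same volume, which is at most that of `M`
  have hFvol : μ.prod (CantorCovers.vol d) F ≤ CantorCovers.vol d (univ : Set M) := by
    rw [(hF.isFundamentalDomain _).measure_eq (hD.univ_prod.isFundamentalDomain _),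
      Measure.prod_prod, measure_univ, one_mul]
    exact hDvol
  obtain ⟨rank, hr⟩ := U.exists_isOrbitRank
  have ht : 0 < lam + CantorCovers.betaConst d := by linarith [CantorCovers.betaConst_pos d]
  obtain ⟨n, hn⟩ : ∃ n, ⌈lam + CantorCovers.betaConst d⌉₊ = n + 1 :=
    Nat.exists_eq_succ_of_ne_zero (Nat.ceil_pos.2 ht).ne'
  have hn1 : (n : ℝ) < lam + CantorCovers.betaConst d := Nat.lt_ceil.1 (by omega)
  have hn2 : lam + CantorCovers.betaConst d ≤ n + 1 := by
    have := Nat.le_ceil (lam + CantorCovers.betaConst d)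
    rw [hn] at this
    exact_mod_cast this
  have hC : (2 : ℝ) ≤ 10 ^ (4 * (d + 3)) :=
    le_trans (by norm_num) (le_self_pow₀ (by norm_num : (1 : ℝ) ≤ 10) (by omega))
  have hnum := CantorCovers.mul_geometric_le_exp hC (zero_le_one.trans hlam) (n := n) (by
    rw [← pow_mul, show 4 * (d + 3) * 2 = 8 * (d + 3) by ring]
    exact hn2)
  rw [← pow_mul, show 4 * (d + 3) * 4 = 16 * (d + 3) by ring] at hnum
  rw [CantorCovers.transverseVol_eq μ hF.1
    (CantorCovers.CantorCover.measurableSet_highMultiplicitySet hself _)]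
  refine (measure_mono (inter_subset_inter_left F
    (CantorCovers.CantorCover.highMultiplicitySet_subset hr hself hn1))).trans ?_
  refine (CantorCovers.CantorCover.measure_highLayerSet_inter_le hr hself hgood hF
    (ne_top_of_le_ne_top hM hFvol) n).trans ?_
  exact mul_le_mul' (ENNReal.ofReal_le_ofReal hnum) hFvol
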